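/- Let $\Gamma$ be a discrete group acting by homeomorphisms on a locally compact Hausdorff space $X$, and suppose that the action is not free, i.e. $sx=x$ for some $x\in X$ and some $s\in\Gamma\setminus\{e\}$. All spaces below are locally compact Hausdorff, and a factor map between $\Gamma$-spaces is a $\Gamma$-equivariant quotient map; it is proper if preimages of compact sets are compact. Then there are a free action of $\Gamma$ by homeomorphisms on a locally compact Hausdorff space $Y$ and a proper factor map $\pi\colon Y\to X$ with the following property. Regard $C_0(X)$ as a $\Gamma$-invariant C*-subalgebra of $C_0(Y)$ via $f\mapsto f\circ\pi$, so that $C_0(X)\rtimes_{\mathrm r}\Gamma\subset C_0(Y)\rtimes_{\mathrm r}\Gamma$ (reduced crossed products). There is a C*-algebra $A$ with $$C_0(X)\rtimes_{\mathrm r}\Gamma\subset A\subset C_0(Y)\rtimes_{\mathrm r}\Gamma$$ such that $A\neq C_0(Z)\rtimes_{\mathrm r}\Gamma$ for every intermediate extension $Z$ of $\pi$, that is, for every locally compact Hausdorff $\Gamma$-space $Z$ with factor maps $p\colon Y\to Z$ and $q\colon Z\to X$ satisfying $q\circ p=\pi$, where $C_0(Z)$ is regarded as a subalgebra of $C_0(Y)$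 via $f\mapsto f\circ p$. -/

import Mathlib

open scoped ZeroAtInfty

universe u v

noncomputable section

namespace CrossedProduct

/-- An action is free if no element other than the identity fixes a point. -/
def IsFreeAction (Γ Y : Type*) [Group Γ] [MulAction Γ Y] : Prop :=
  ∀ (s : Γ) (y : Y), s • y = y → s = 1

/-- A factor map between two `Γ`-spaces: an equivariant (topological) quotient map. -/
structure IsFactorMap (Γ : Type*) {Y X : Type*} [Group Γ] [TopologicalSpace Y]
    [TopologicalSpace X] [MulAction Γ Y] [MulAction Γ X] (π : Y → X) : Prop where
  isQuotientMap : Topology.IsQuotientMap π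
  equivariant : ∀ (s : Γ) (y : Y), π (s • y) = s • π y

/-- A proper factor map: preimages of compact sets are compact. -/
structure IsProperFactorMap (Γ : Type*) {Y X : Type*} [Group Γ] [TopologicalSpace Y]
    [TopologicalSpace X] [MulAction Γ Y] [MulAction Γ X] (π : Y → X) : Prop
    extends IsFactorMap Γ π where
  isCompact_preimage : ∀ K : Set X, IsCompact K → IsCompact (π ⁻¹' K)

/-- The Hilbert space `ℓ²(Γ) ⊗ ℓ²(Y) = ℓ²(Γ × Y)`. -/
abbrev L2 (Γ Y : Type*) : Type _ := lp (fun _ : Γ × Y => ℂ) 2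

/-- The representation of `C₀(Y)` in the left regular representation of the system `Γ ↷ C₀(Y)`
induced from the faithful representation of `C₀(Y)` on `ℓ²(Y)` by multiplication:
`(f ξ)(t, y) = (t⁻¹ · f)(y) ξ(t, y) = f (t y) ξ(t, y)`. -/
def mulOp (Γ : Type*) {Y : Type*} [Group Γ] [TopologicalSpace Y] [MulAction Γ Y]
    (f : C₀(Y, ℂ)) : L2 Γ Y →L[ℂ] L2 Γ Y :=
  lp.mapCLM 2 (fun i : Γ × Y => f (i.1 • i.2) • ContinuousLinearMap.id ℂ ℂ) (K := ‖f‖)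
    (norm_nonneg f)
    (fun i => by
      rw [norm_smul]
      simpa using f.toBCF.norm_coe_le_norm (i.1 • i.2))

theorem mulOp_apply (Γ : Type*) {Y : Type*} [Group Γ] [TopologicalSpace Y] [MulAction Γ Y]
    (f : C₀(Y, ℂ)) (ξ : L2 Γ Y) (t : Γ) (y : Y) :
    mulOp Γ f ξ (t, y) = f (t • y) * ξ (t, y) :=
  rfl

theorem memlp_translate {Γ Y : Type*} [Group Γ] (s : Γ) (ξ : L2 Γ Y) :
    Memℓp (fun i : Γ × Y => ξ (s⁻¹ * i.1, i.2)) 2 :=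
  memℓp_gen ((((lp.memℓp ξ).summable (by simp)).comp_injective
    ((Equiv.mulLeft s⁻¹).prodCongr (Equiv.refl Y)).injective))

/-- The unitary `λ_s ⊗ 1` implementing `s`: `(u_s ξ)(t, y) = ξ(s⁻¹ t, y)`. -/
def transOp {Γ : Type*} (Y : Type*) [Group Γ] (s : Γ) : L2 Γ Y →L[ℂ] L2 Γ Y :=
  LinearMap.mkContinuous
    { toFun := fun ξ => ⟨fun i : Γ × Y => ξ (s⁻¹ * i.1, i.2), memlp_translate s ξ⟩
      map_add' := fun _ _ => rfl
      map_smul' := fun _ _ => rfl } 1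
    (fun ξ => by
      refine lp.norm_le_of_tsum_le (by simp) (by positivity) ?_
      rw [one_mul, lp.norm_rpow_eq_tsum (by simp)]
      exact le_of_eq (((Equiv.mulLeft s⁻¹).prodCongr (Equiv.refl Y)).tsum_eq
        (fun i : Γ × Y => ‖ξ i‖ ^ (2 : ENNReal).toReal)))

theorem transOp_apply {Γ : Type*} (Y : Type*) [Group Γ] (s : Γ) (ξ : L2 Γ Y) (t : Γ) (y : Y) :
    transOp Y s ξ (t, y) = ξ (s⁻¹ * t, y) :=
  rfl

/-- The copy of `C₀(Z)` in `C₀(Y)` given by a map `p : Y → Z`, that is `{f ∘ p : f ∈ C₀(Z)}`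
(for a proper continuous `p` every `f ∘ p` is in `C₀(Y)`). -/
def pullback {Y Z : Type*} [TopologicalSpace Y] [TopologicalSpace Z] (p : Y → Z) :
    NonUnitalStarSubalgebra ℂ C₀(Y, ℂ) where
  carrier := {g | ∃ f : C₀(Z, ℂ), ∀ y, g y = f (p y)}
  add_mem' := by
    rintro _ _ ⟨f, hf⟩ ⟨f', hf'⟩
    exact ⟨f + f', fun y => by simp [hf, hf']⟩
  zero_mem' := ⟨0, fun y => by simp⟩
  mul_mem' := by
    rintro _ _ ⟨f, hf⟩ ⟨f', hf'⟩
    exact ⟨f * f', fun y => by simp [hf, hf']⟩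
  smul_mem' := by
    rintro c _ ⟨f, hf⟩
    exact ⟨c • f, fun y => by simp [hf]⟩
  star_mem' := by
    rintro _ ⟨f, hf⟩
    exact ⟨star f, fun y => by simp [hf]⟩

/-- The reduced crossed product `D ⋊_r Γ` of a `Γ`-invariant C*-subalgebra `D` of `C₀(Y)`: the
C*-algebra generated by the operators `f u_s`, `f ∈ D`, `s ∈ Γ`, in the regular representation
induced from the faithful representation `D ⊆ C₀(Y) ⊆ B(ℓ²(Y))`. For `D ⊆ D'` it realizes the
canonical inclusion `D ⋊_r Γ ⊆ D' ⋊_r Γ`. -/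
def reducedCrossedProduct (Γ : Type*) {Y : Type*} [Group Γ] [TopologicalSpace Y] [MulAction Γ Y]
    (D : NonUnitalStarSubalgebra ℂ C₀(Y, ℂ)) :
    NonUnitalStarSubalgebra ℂ (L2 Γ Y →L[ℂ] L2 Γ Y) :=
  (NonUnitalStarAlgebra.adjoin ℂ
    {T | ∃ f ∈ D, ∃ s : Γ, T = mulOp Γ f * transOp Y s}).topologicalClosure

end CrossedProduct

end

/-! Fix `s ≠ 1` with `s • x = x`. Take `Y = X × FreeShift ζ`, where the second factor is a compact
free `Γ`-space with an extra unconstrained `Bool` label on each group element. Let `p = cutoff ζ φ`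
with `φ x = 1`, and let `A` be generated by `C₀(X) ⋊ Γ` and `p - p u_s`.

If `A` were `C₀(Z) ⋊ Γ`, it would contain the diagonal part of `p - p u_s`, which is `p`
(`mulOp_cutoff_mem_reducedCrossedProduct`). But `p` is not in `A`. Choose two points of `Y` over `x`
whose labels are identically `false`, respectively the indicator of `⟨s⟩`, and test on long sums of
basis vectors along `h s ^ k`. Functions from `X` cannot tell the two points apart, since `s` fixes
`x`; and `p (1 - u_s)` is negligible over both, because the sums are almost `s`-invariant. So the
algebra generated before closure acts asymptotically alike over both points, whereas `p` is `0` over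
one and the identity over the other; `HasCommonAsymptotics.notMem_closure` turns this into a gap in
norm. -/

noncomputable section

namespace CrossedProduct

/-! ### A compact free `Γ`-space with `Bool` labels. -/

section FreeShift

/-- Every group element acts on the group by left translation as a rotation: there are `ζ s ∈ 𝕋`,
with `ζ s ≠ 1` for `s ≠ 1`, and functions `c : Γ → 𝕋` with `c (s t) = ζ s * c t`. -/
theorem exists_rotation_factor (Γ : Type*) [Group Γ] :
    ∃ ζ : Γ → Circle, (∀ s, s ≠ 1 → ζ s ≠ 1) ∧
      ∀ s, ∃ c : Γ → Circle, ∀ t, c (s * t) = ζ s * c t := by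
  have key : ∀ s : Γ, ∃ z : Circle, (s ≠ 1 → z ≠ 1) ∧ z ^ orderOf s = 1 := by
    intro s
    by_cases h0 : orderOf s = 0
    -- For infinite order there is no relation to respect, so `-1` serves as well as any nontrivial
    -- rotation.
    · refine ⟨Circle.exp Real.pi, fun _ h => ?_, by simp [h0]⟩
      have := congrArg (fun z : Circle => (z : ℂ)) h
      simp only [Circle.coe_exp, Complex.exp_pi_mul_I, Circle.coe_one] at this
      norm_num at this
    · have hpos : (0 : ℝ) < orderOf s := by exact_mod_cast Nat.pos_of_ne_zero h0
      refine ⟨Circle.exp (2 * Real.pi / orderOf s), fun hs h => ?_, ?_⟩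
      · obtain ⟨n, hn⟩ := Circle.exp_eq_one.1 h
        have hpi := Real.two_pi_pos
        have h1 : (n : ℝ) * orderOf s = 1 := by
          rw [div_eq_iff hpos.ne'] at hn
          have : 2 * Real.pi * 1 = 2 * Real.pi * ((n : ℝ) * orderOf s) := by linarith
          exact (mul_left_cancel₀ hpi.ne' this).symm
        have h2 : n * (orderOf s : ℤ) = 1 := by exact_mod_cast h1
        have h3 : (orderOf s : ℤ) ∣ 1 := ⟨n, by rw [← h2, mul_comm]⟩
        have h4 : orderOf s = 1 := by
          exact Nat.dvd_one.1 (by exact_mod_cast h3)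
        exact hs (orderOf_eq_one_iff.1 h4)
      · rw [← Circle.exp_nsmul, Circle.exp_eq_one]
        exact ⟨1, by rw [nsmul_eq_mul]; field_simp; simp⟩
  choose ζ hζ hord using key
  refine ⟨ζ, hζ, fun s => ?_⟩
  -- Write `t = s ^ n * r` with `r` a representative of the coset `⟨s⟩ t` and put `c t = ζ s ^ n`;
  -- `n` matters only modulo the order of `s`.
  let R := QuotientGroup.rightRel (Subgroup.zpowers s)
  have hrep : ∀ t : Γ, ∃ n : ℤ, s ^ n * (Quotient.mk R t).out = t := by
    intro t
    have h : R (Quotient.mk R t).out t := Quotient.exact (Quotient.out_eq _)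
    obtain ⟨n, hn⟩ := Subgroup.mem_zpowers_iff.1 (QuotientGroup.rightRel_apply.1 h)
    exact ⟨n, by rw [hn]; group⟩
  choose n hn using hrep
  refine ⟨fun t => ζ s ^ n t, fun t => ?_⟩
  have hq : Quotient.mk R (s * t) = Quotient.mk R t := by
    refine Quotient.sound (QuotientGroup.rightRel_apply.2 ?_)
    simp
  have h1 := hn (s * t)
  rw [hq] at h1
  have h2 : s ^ n (s * t) = s ^ (1 + n t) := by
    apply mul_right_cancel (b := (Quotient.mk R t).out)
    rw [h1, zpow_add, zpow_one, mul_assoc, hn t]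
  have h3 : n (s * t) ≡ 1 + n t [ZMOD orderOf (ζ s)] :=
    (zpow_eq_zpow_iff_modEq.1 h2).of_dvd (by exact_mod_cast orderOf_dvd_of_pow_eq_one (hord s))
  change ζ s ^ n (s * t) = ζ s * ζ s ^ n t
  rw [zpow_eq_zpow_iff_modEq.2 h3, zpow_add, zpow_one]

/-- The space of pairs of functions `Γ → (Γ → 𝕋)` and `Γ → {0, 1}` whose first component has, for
each `s`, an `s`-th coordinate that is rotated by `ζ s` under left translation by `s`. -/
def FreeShift {Γ : Type u} [Group Γ] (ζ : Γ → Circle) : Type u :=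
  {c : Γ → (Γ → Circle) × Bool // ∀ s t, (c (s * t)).1 s = ζ s * (c t).1 s}

namespace FreeShift

variable {Γ : Type u} [Group Γ] {ζ : Γ → Circle}

instance : TopologicalSpace (FreeShift ζ) := instTopologicalSpaceSubtype

instance : T2Space (FreeShift ζ) :=
  inferInstanceAs (T2Space (Subtype _))

theorem continuous_val : Continuous (fun c : FreeShift ζ => c.1) := continuous_subtype_val

instance : CompactSpace (FreeShift ζ) := by
  have h : IsClosed {c : Γ → (Γ → Circle) × Bool | ∀ s t, (c (s * t)).1 s = ζ s * (c t).1 s} := by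
    simp only [Set.ofPred_forall]
    exact isClosed_iInter fun s => isClosed_iInter fun t => isClosed_eq (by fun_prop) (by fun_prop)
  exact isCompact_iff_compactSpace.1 h.isCompact

/-- The group acts by right translation of the argument. -/
instance : MulAction Γ (FreeShift ζ) where
  smul g c := ⟨fun t => c.1 (t * g), fun s t =>
    (congrArg (fun r => (c.1 r).1 s) (mul_assoc s t g)).trans (c.2 s (t * g))⟩
  one_smul c := Subtype.ext (funext fun t => congrArg c.1 (mul_one t))
  mul_smul g h c := Subtype.ext (funext fun t => congrArg c.1 (mul_assoc t g h).symm)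

theorem smul_val (g : Γ) (c : FreeShift ζ) (t : Γ) : (g • c).1 t = c.1 (t * g) := rfl

instance : ContinuousConstSMul Γ (FreeShift ζ) where
  continuous_const_smul g :=
    Continuous.subtype_mk (continuous_pi fun t => (continuous_apply (t * g)).comp continuous_val) _

/-- If `s` fixes `c`, then `c s = c 1`, yet the `s`-th circle coordinates of these differ by the
factor `ζ s`. -/
theorem isFreeAction (hζ : ∀ s, s ≠ 1 → ζ s ≠ 1) : IsFreeAction Γ (FreeShift ζ) := by
  intro s c h
  by_contra hs
  have h1 : c.1 s = c.1 1 := by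
    have := smul_val s c 1
    rw [h, one_mul] at this
    exact this.symm
  have h2 := c.2 s 1
  rw [mul_one, h1] at h2
  exact hζ s hs (by simpa using h2.symm)

/-- A point of the space with prescribed second component. -/
theorem exists_snd_eq (h : ∀ s, ∃ c : Γ → Circle, ∀ t, c (s * t) = ζ s * c t) (b : Γ → Bool) :
    ∃ c : FreeShift ζ, ∀ t, (c.1 t).2 = b t := by
  choose c hc using h
  exact ⟨⟨fun t => (fun s => c s t, b t), fun s t => hc s t⟩, fun _ => rfl⟩

end FreeShift

end FreeShift

/-! ### Covariance relations of the regular representation. -/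

section Operators

variable {Γ : Type*} {Y : Type*}

/-- The basis vector of `ℓ²(Γ × Y)` at `(t, y)`. -/
def basisVec (t : Γ) (y : Y) : L2 Γ Y :=
  open Classical in lp.single 2 (t, y) (1 : ℂ)

open Classical in
theorem basisVec_apply (t : Γ) (y : Y) (i : Γ × Y) :
    basisVec t y i = if i = (t, y) then 1 else 0 := by
  rw [basisVec, lp.single_apply, Pi.single_apply]

theorem norm_basisVec (t : Γ) (y : Y) : ‖basisVec t y‖ = 1 := by
  classical
  have := lp.norm_single (E := fun _ : Γ × Y => ℂ) (p := 2) (by norm_num) (t, y) 1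
  rw [norm_one] at this
  rw [basisVec]
  convert this

theorem inner_basisVec_left (t : Γ) (y : Y) (ξ : L2 Γ Y) :
    inner ℂ (basisVec t y) ξ = ξ (t, y) := by
  classical
  have := lp.inner_single_left (𝕜 := ℂ) (G := fun _ : Γ × Y => ℂ) (t, y) 1 ξ
  rw [basisVec]
  convert this using 1
  simp

open Classical in
theorem inner_basisVec_basisVec (t t' : Γ) (y : Y) :
    inner ℂ (basisVec t y) (basisVec t' y) = if t = t' then 1 else 0 := by
  rw [inner_basisVec_left, basisVec_apply]
  simp

variable [Group Γ]

theorem transOp_basisVec (s t : Γ) (y : Y) :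
    transOp Y s (basisVec t y) = basisVec (s * t) y := by
  classical
  ext ⟨r, z⟩
  rw [transOp_apply, basisVec_apply, basisVec_apply]
  simp [inv_mul_eq_iff_eq_mul]

theorem transOp_one : transOp Y (1 : Γ) = 1 := by
  ext ξ ⟨r, z⟩
  rw [transOp_apply]
  simp

theorem transOp_mul (s t : Γ) : transOp Y s * transOp Y t = transOp Y (s * t) := by
  ext ξ ⟨r, z⟩
  rw [mul_apply_eq_comp, transOp_apply, transOp_apply, transOp_apply, mul_inv_rev,
    mul_assoc]

theorem star_transOp (s : Γ) : star (transOp Y s) = transOp Y s⁻¹ := by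
  rw [ContinuousLinearMap.star_eq_adjoint, eq_comm, ContinuousLinearMap.eq_adjoint_iff]
  intro ξ η
  rw [lp.inner_eq_tsum, lp.inner_eq_tsum,
    ← ((Equiv.mulLeft s⁻¹).prodCongr (Equiv.refl Y)).tsum_eq]
  refine tsum_congr fun i => ?_
  obtain ⟨t, y⟩ := i
  rw [transOp_apply]
  simp [transOp_apply]

variable [TopologicalSpace Y] [MulAction Γ Y]

theorem mulOp_basisVec (f : C₀(Y, ℂ)) (t : Γ) (y : Y) :
    mulOp Γ f (basisVec t y) = f (t • y) • basisVec t y := by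
  classical
  ext ⟨r, z⟩
  rw [mulOp_apply, lp.coeFn_smul, Pi.smul_apply, basisVec_apply, smul_eq_mul]
  split_ifs with h
  · obtain ⟨rfl, rfl⟩ := Prod.mk.inj h; rfl
  · simp

theorem mulOp_sub (f g : C₀(Y, ℂ)) : mulOp Γ (f - g) = mulOp Γ f - mulOp Γ g := by
  ext ξ ⟨r, z⟩
  simp only [mulOp_apply, sub_apply, lp.coeFn_sub, Pi.sub_apply,
    ZeroAtInftyContinuousMap.sub_apply, sub_mul]

theorem norm_mulOp_le (f : C₀(Y, ℂ)) : ‖mulOp Γ f‖ ≤ ‖f‖ :=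
  lp.norm_mapCLM_le ..

theorem star_mulOp (f : C₀(Y, ℂ)) : star (mulOp Γ f) = mulOp Γ (star f) := by
  rw [ContinuousLinearMap.star_eq_adjoint, eq_comm, ContinuousLinearMap.eq_adjoint_iff]
  intro ξ η
  rw [lp.inner_eq_tsum, lp.inner_eq_tsum]
  refine tsum_congr fun i => ?_
  obtain ⟨t, y⟩ := i
  simp [mulOp_apply]
  ring

theorem mulOp_mul_mulOp (f g : C₀(Y, ℂ)) : mulOp Γ f * mulOp Γ g = mulOp Γ (f * g) := by
  ext ξ ⟨r, z⟩
  simp only [mul_apply_eq_comp, mulOp_apply, ZeroAtInftyContinuousMap.mul_apply,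
    mul_assoc]

theorem transOp_mul_mulOp (s : Γ) {f f' : C₀(Y, ℂ)} (h : ∀ y, f' y = f (s⁻¹ • y)) :
    transOp Y s * mulOp Γ f = mulOp Γ f' * transOp Y s := by
  ext ξ ⟨r, z⟩
  simp only [mul_apply_eq_comp, mulOp_apply, transOp_apply, h, mul_smul]

end Operators

/-! ### The diagonal expectation. -/

section Expectation

variable {Γ : Type*} {Y : Type*} [Group Γ] [TopologicalSpace Y] [MulAction Γ Y]
  {D : NonUnitalStarSubalgebra ℂ C₀(Y, ℂ)}

/-- Covariance moves each `u_s` to the right of functions, so for invariant `D` the span of the `f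
u_s` is already closed under products and adjoints. -/
theorem mem_span_of_mem_adjoin (hD : ∀ f ∈ D, ∀ g : Γ, ∃ f' ∈ D, ∀ y, f' y = f (g • y))
    {a : L2 Γ Y →L[ℂ] L2 Γ Y}
    (ha : a ∈ NonUnitalStarAlgebra.adjoin ℂ
      {T | ∃ f ∈ D, ∃ s : Γ, T = mulOp Γ f * transOp Y s}) :
    a ∈ Submodule.span ℂ {T | ∃ f ∈ D, ∃ s : Γ, T = mulOp Γ f * transOp Y s} := by
  induction ha using NonUnitalStarAlgebra.adjoin_induction with
  | mem x hx => exact Submodule.subset_span hx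
  | add x y _ _ hx hy => exact add_mem hx hy
  | zero => exact zero_mem _
  | smul r x _ hx => exact Submodule.smul_mem _ r hx
  | mul x y _ _ hx hy =>
    have hxy := Submodule.mul_mem_mul hx hy
    rw [Submodule.span_mul_span] at hxy
    refine Submodule.span_mono ?_ hxy
    rintro _ ⟨_, ⟨f, hf, s, rfl⟩, _, ⟨g, hg, t, rfl⟩, rfl⟩
    obtain ⟨g', hg', h⟩ := hD g hg s⁻¹
    refine ⟨f * g', mul_mem hf hg', s * t, ?_⟩
    change mulOp Γ f * transOp Y s * (mulOp Γ g * transOp Y t) = _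
    rw [mul_assoc, ← mul_assoc (transOp Y s), transOp_mul_mulOp s h, mul_assoc, transOp_mul,
      ← mul_assoc, mulOp_mul_mulOp]
  | star x hx' hx =>
    clear hx'
    induction hx using Submodule.span_induction with
    | mem x hx =>
      obtain ⟨f, hf, s, rfl⟩ := hx
      obtain ⟨f', hf', h⟩ := hD (star f) (star_mem hf) s
      refine Submodule.subset_span ⟨f', hf', s⁻¹, ?_⟩
      rw [star_mul, star_mulOp, star_transOp, transOp_mul_mulOp s⁻¹ (by simpa using h)]
    | zero => simp
    | add x y _ _ hx hy => rw [star_add]; exact add_mem hx hy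
    | smul r x _ hx => rw [star_smul]; exact Submodule.smul_mem _ _ hx

/-- The diagonal coefficients of an element of the reduced crossed product of `D` are uniformly
approximated by elements of `D`. -/
theorem exists_mem_norm_sub_diagonal_le
    (hD : ∀ f ∈ D, ∀ g : Γ, ∃ f' ∈ D, ∀ y, f' y = f (g • y))
    {T : L2 Γ Y →L[ℂ] L2 Γ Y} (hT : T ∈ reducedCrossedProduct Γ D) {ε : ℝ} (hε : 0 < ε) :
    ∃ f ∈ D, ∀ y, ‖f y - T (basisVec 1 y) (1, y)‖ ≤ ε := by
  obtain ⟨a, ha, hTa⟩ := Metric.mem_closure_iff.1 hT ε hε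
  have hdiag : ∃ f ∈ D, ∀ y, f y = a (basisVec 1 y) (1, y) := by
    have hspan := mem_span_of_mem_adjoin hD ha
    clear ha hTa
    induction hspan using Submodule.span_induction with
    | mem x hx =>
      obtain ⟨f, hf, s, rfl⟩ := hx
      -- For `s ≠ 1` the vector at `1` is sent to a multiple of the one at `s`, orthogonal to it.
      by_cases hs : s = 1
      · subst hs
        refine ⟨f, hf, fun y => ?_⟩
        rw [mul_apply_eq_comp, transOp_basisVec, mulOp_basisVec]
        simp [basisVec_apply]
      · refine ⟨0, zero_mem _, fun y => ?_⟩
        rw [mul_apply_eq_comp, transOp_basisVec, mulOp_basisVec]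
        simp [basisVec_apply, Ne.symm hs]
    | zero => exact ⟨0, zero_mem _, fun y => by simp⟩
    | add x y _ _ hx hy =>
      obtain ⟨f, hf, hf'⟩ := hx
      obtain ⟨g, hg, hg'⟩ := hy
      exact ⟨f + g, add_mem hf hg, fun y => by simp [hf', hg']⟩
    | smul r x _ hx =>
      obtain ⟨f, hf, hf'⟩ := hx
      exact ⟨r • f, SMulMemClass.smul_mem r hf, fun y => by simp [hf']⟩
  obtain ⟨f, hf, hfa⟩ := hdiag
  refine ⟨f, hf, fun y => ?_⟩
  have h1 : f y - T (basisVec 1 y) (1, y) = inner ℂ (basisVec 1 y) ((a - T) (basisVec 1 y)) := by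
    rw [inner_basisVec_left, hfa]; rfl
  calc ‖f y - T (basisVec 1 y) (1, y)‖ ≤ ‖basisVec (1 : Γ) y‖ * ‖(a - T) (basisVec 1 y)‖ := by
        rw [h1]; exact norm_inner_le_norm _ _
    _ ≤ ‖basisVec (1 : Γ) y‖ * (‖a - T‖ * ‖basisVec (1 : Γ) y‖) := by
        gcongr; exact (a - T).le_opNorm _
    _ ≤ ε := by
        rw [norm_basisVec, one_mul, mul_one, ← dist_eq_norm, dist_comm]; exact hTa.le

end Expectation

/-! ### Almost invariant vectors over two points. -/

section Asymptotics

open Asymptotics Filter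

variable {Γ : Type*} {Y : Type*} [Group Γ]

/-- The linear map sending `δ_h` to the sum of the basis vectors at `(h s ^ k, y)`, `k < n`. -/
def folnerVec (s : Γ) (y : Y) (n : ℕ) : (Γ →₀ ℂ) →ₗ[ℂ] L2 Γ Y :=
  Finsupp.linearCombination ℂ fun h => ∑ k ∈ Finset.range n, basisVec (h * s ^ k) y

theorem folnerVec_single (s : Γ) (y : Y) (n : ℕ) (h : Γ) (r : ℂ) :
    folnerVec s y n (Finsupp.single h r) = r • ∑ k ∈ Finset.range n, basisVec (h * s ^ k) y := by
  simp [folnerVec]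

/-- The Gram matrix of the basis vectors over a point does not depend on the point. This lets the
same coefficients be compared over two points. -/
theorem norm_folnerVec_eq (s : Γ) (y y' : Y) (n : ℕ) (c : Γ →₀ ℂ) :
    ‖folnerVec s y n c‖ = ‖folnerVec s y' n c‖ := by
  classical
  have h : inner ℂ (folnerVec s y n c) (folnerVec s y n c) =
      inner ℂ (folnerVec s y' n c) (folnerVec s y' n c) := by
    simp only [folnerVec, Finsupp.linearCombination_apply, Finsupp.sum, sum_inner, inner_sum,
      inner_smul_left, inner_smul_right, inner_basisVec_basisVec]
  rw [inner_self_eq_norm_sq_to_K, inner_self_eq_norm_sq_to_K] at h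
  have h' : ‖folnerVec s y n c‖ ^ 2 = ‖folnerVec s y' n c‖ ^ 2 := by exact_mod_cast h
  exact (pow_left_inj₀ (norm_nonneg _) (norm_nonneg _) two_ne_zero).1 h'

/-- The diagonal inner products contribute `n` and the others are nonnegative; they can be positive
when `s` has finite order, as the powers then repeat. -/
theorem sqrt_le_norm_folnerVec (s : Γ) (y : Y) (n : ℕ) :
    √n ≤ ‖folnerVec s y n (Finsupp.single 1 1)‖ := by
  classical
  refine Real.sqrt_le_iff.2 ⟨norm_nonneg _, ?_⟩
  rw [@norm_sq_eq_re_inner ℂ, folnerVec_single, one_smul]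
  simp only [sum_inner, inner_sum, inner_basisVec_basisVec, map_sum]
  calc (n : ℝ) = ∑ _k ∈ Finset.range n, (1 : ℝ) := by simp
    _ ≤ _ := by
      refine Finset.sum_le_sum fun k hk => ?_
      refine le_trans ?_ (Finset.single_le_sum (fun j _ => ?_) hk)
      · simp
      · split_ifs <;> simp

theorem tendsto_norm_folnerVec (s : Γ) (y : Y) :
    Tendsto (fun n => ‖folnerVec s y n (Finsupp.single 1 1)‖) atTop atTop :=
  tendsto_atTop_mono (sqrt_le_norm_folnerVec s y)
    (Real.tendsto_sqrt_atTop.comp tendsto_natCast_atTop_atTop)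

/-- Shifting by `s` on the right telescopes, leaving two end vectors. -/
theorem norm_folnerVec_sub_le (s : Γ) (y : Y) (n : ℕ) (h : Γ) (r : ℂ) :
    ‖folnerVec s y n (Finsupp.single h r) - folnerVec s y n (Finsupp.single (h * s) r)‖
      ≤ ‖r‖ * 2 := by
  have h1 : ∑ k ∈ Finset.range n, basisVec (h * s ^ k) y
      - ∑ k ∈ Finset.range n, basisVec (h * s * s ^ k) y
      = basisVec h y - basisVec (h * s ^ n) y := by
    rw [← Finset.sum_sub_distrib]
    simp only [mul_assoc, ← pow_succ']
    rw [Finset.sum_range_sub' (fun k => basisVec (h * s ^ k) y)]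
    simp
  rw [folnerVec_single, folnerVec_single, ← smul_sub, h1, norm_smul]
  gcongr
  refine (norm_sub_le _ _).trans ?_
  rw [norm_basisVec, norm_basisVec]
  norm_num

theorem isLittleO_folnerVec_sub (s : Γ) (y : Y) {a b : Γ} (h : b = a * s ∨ a = b * s) :
    (fun n => folnerVec s y n (Finsupp.single a 1) - folnerVec s y n (Finsupp.single b 1))
      =o[atTop] fun n => ‖folnerVec s y n (Finsupp.single 1 1)‖ := by
  have hO : (fun n => folnerVec s y n (Finsupp.single a 1) - folnerVec s y n (Finsupp.single b 1))
      =O[atTop] fun _ : ℕ => (1 : ℝ) := by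
    refine IsBigO.of_bound 2 (Eventually.of_forall fun n => ?_)
    rcases h with rfl | rfl
    · simpa using norm_folnerVec_sub_le s y n a 1
    · rw [norm_sub_rev]; simpa using norm_folnerVec_sub_le s y n b 1
  refine hO.trans_isLittleO ((isLittleO_const_left).2 (.inr ?_))
  simpa [Function.comp_def] using tendsto_norm_folnerVec s y

theorem transOp_folnerVec_single (s : Γ) (y : Y) (n : ℕ) (g h : Γ) (r : ℂ) :
    transOp Y g (folnerVec s y n (Finsupp.single h r))
      = folnerVec s y n (Finsupp.single (g * h) r) := by
  simp only [folnerVec_single, map_smul, map_sum, transOp_basisVec, mul_assoc]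

theorem mulOp_folnerVec_single [TopologicalSpace Y] [MulAction Γ Y] (s : Γ) (y : Y) (n : ℕ)
    (f : C₀(Y, ℂ)) (h : Γ) (r w : ℂ) (hf : ∀ k : ℕ, f ((h * s ^ k) • y) = w) :
    mulOp Γ f (folnerVec s y n (Finsupp.single h r)) =
      folnerVec s y n (Finsupp.single h (w * r)) := by
  simp only [folnerVec_single, map_smul, map_sum, mulOp_basisVec, hf, ← Finset.smul_sum,
    smul_smul, mul_comm]

/-- The operator `a` acts in the same way, up to lower order terms, on the almost invariant vectors
over `y₁` and over `y₂`. -/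
def HasCommonAsymptotics (s : Γ) (y₁ y₂ : Y) (a : L2 Γ Y →L[ℂ] L2 Γ Y) : Prop :=
  ∀ c : Γ →₀ ℂ, ∃ c' : Γ →₀ ℂ, ∀ y : Y, y = y₁ ∨ y = y₂ →
    (fun n => a (folnerVec s y n c) - folnerVec s y n c')
      =o[atTop] fun n => ‖folnerVec s y n (Finsupp.single 1 1)‖

namespace HasCommonAsymptotics

variable {s : Γ} {y₁ y₂ : Y} {a b : L2 Γ Y →L[ℂ] L2 Γ Y}

theorem zero : HasCommonAsymptotics s y₁ y₂ 0 :=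
  fun _ => ⟨0, fun y _ => by simp⟩

theorem add (ha : HasCommonAsymptotics s y₁ y₂ a) (hb : HasCommonAsymptotics s y₁ y₂ b) :
    HasCommonAsymptotics s y₁ y₂ (a + b) := fun c => by
  obtain ⟨c₁, h₁⟩ := ha c
  obtain ⟨c₂, h₂⟩ := hb c
  refine ⟨c₁ + c₂, fun y hy => ((h₁ y hy).add (h₂ y hy)).congr_left fun n => ?_⟩
  rw [map_add, add_apply]
  abel

theorem smul (r : ℂ) (ha : HasCommonAsymptotics s y₁ y₂ a) :
    HasCommonAsymptotics s y₁ y₂ (r • a) := fun c => by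
  obtain ⟨c₁, h₁⟩ := ha c
  refine ⟨r • c₁, fun y hy => ((h₁ y hy).const_smul_left r).congr_left fun n => ?_⟩
  simp [smul_sub]

theorem mul (ha : HasCommonAsymptotics s y₁ y₂ a) (hb : HasCommonAsymptotics s y₁ y₂ b) :
    HasCommonAsymptotics s y₁ y₂ (a * b) := fun c => by
  obtain ⟨c₁, h₁⟩ := hb c
  obtain ⟨c₂, h₂⟩ := ha c₁
  refine ⟨c₂, fun y hy =>
    (((a.isBigO_comp _ _).trans_isLittleO (h₁ y hy)).add (h₂ y hy)).congr_left fun n => ?_⟩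
  simp

theorem of_single (h : ∀ g : Γ, ∃ c' : Γ →₀ ℂ, ∀ y : Y, y = y₁ ∨ y = y₂ →
    (fun n => a (folnerVec s y n (Finsupp.single g 1)) - folnerVec s y n c')
      =o[atTop] fun n => ‖folnerVec s y n (Finsupp.single 1 1)‖) :
    HasCommonAsymptotics s y₁ y₂ a := fun c => by
  induction c using Finsupp.induction_linear with
  | zero => exact ⟨0, fun y _ => by simp⟩
  | add c d hc hd =>
    obtain ⟨c₁, h₁⟩ := hc
    obtain ⟨c₂, h₂⟩ := hd
    refine ⟨c₁ + c₂, fun y hy => ((h₁ y hy).add (h₂ y hy)).congr_left fun n => ?_⟩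
    simp only [map_add]
    abel
  | single g r =>
    obtain ⟨c₁, h₁⟩ := h g
    refine ⟨r • c₁, fun y hy => ((h₁ y hy).const_smul_left r).congr_left fun n => ?_⟩
    have : Finsupp.single g r = r • Finsupp.single g (1 : ℂ) := by simp
    rw [this]
    simp only [map_smul, Pi.smul_apply, smul_sub]

theorem of_mem_adjoin {S : Set (L2 Γ Y →L[ℂ] L2 Γ Y)}
    (hS : ∀ T ∈ S, HasCommonAsymptotics s y₁ y₂ T ∧ HasCommonAsymptotics s y₁ y₂ (star T))
    (ha : a ∈ NonUnitalStarAlgebra.adjoin ℂ S) : HasCommonAsymptotics s y₁ y₂ a := by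
  -- The property is not visibly stable under adjoints, so the induction carries it for `a` and
  -- `star a` together.
  suffices HasCommonAsymptotics s y₁ y₂ a ∧ HasCommonAsymptotics s y₁ y₂ (star a) from this.1
  induction ha using NonUnitalStarAlgebra.adjoin_induction with
  | mem x hx => exact hS x hx
  | add x y _ _ hx hy => exact ⟨hx.1.add hy.1, by rw [star_add]; exact hx.2.add hy.2⟩
  | zero => exact ⟨zero, by rw [star_zero]; exact zero⟩
  | smul r x _ hx => exact ⟨hx.1.smul r, by rw [star_smul]; exact hx.2.smul _⟩
  | mul x y _ _ hx hy => exact ⟨hx.1.mul hy.1, by rw [star_mul]; exact hy.2.mul hx.2⟩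
  | star x _ hx => exact ⟨hx.2, by rw [star_star]; exact hx.1⟩

/-- An operator that vanishes on the almost invariant vectors over `y₁` and fixes those over `y₂`
is not a limit of operators with common asymptotics. -/
theorem notMem_closure {B : Set (L2 Γ Y →L[ℂ] L2 Γ Y)}
    (hB : ∀ b ∈ B, HasCommonAsymptotics s y₁ y₂ b)
    (h₁ : ∀ n, a (folnerVec s y₁ n (Finsupp.single 1 1)) = 0)
    (h₂ : ∀ n, a (folnerVec s y₂ n (Finsupp.single 1 1))
      = folnerVec s y₂ n (Finsupp.single 1 1)) : a ∉ closure B := by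
  intro ha
  -- Four errors of size `N / 8` will give `N ≤ N / 2`; any constant below `1 / 4` would do.
  obtain ⟨b, hb, hab⟩ := Metric.mem_closure_iff.1 ha (1 / 8) (by norm_num)
  rw [dist_eq_norm] at hab
  obtain ⟨c, hc⟩ := hB b hb (Finsupp.single 1 1)
  obtain ⟨n, hn₁, hn₂, hn⟩ := (((hc y₁ (.inl rfl)).bound (c := 1 / 8) (by norm_num)).and
    (((hc y₂ (.inr rfl)).bound (c := 1 / 8) (by norm_num)).and
      ((tendsto_norm_folnerVec s y₁).eventually_gt_atTop 0))).exists
  rw [norm_norm] at hn₁ hn₂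
  rw [norm_folnerVec_eq s y₂ y₁] at hn₂
  have e₁ := (a - b).le_of_opNorm_le hab.le (folnerVec s y₁ n (Finsupp.single 1 1))
  have e₂ := (a - b).le_of_opNorm_le hab.le (folnerVec s y₂ n (Finsupp.single 1 1))
  rw [norm_folnerVec_eq s y₂ y₁] at e₂
  rw [sub_apply, h₁] at e₁
  rw [sub_apply, h₂] at e₂
  have hN := norm_folnerVec_eq s y₂ y₁ n (Finsupp.single 1 1)
  have hc' := norm_folnerVec_eq s y₂ y₁ n c
  set N := ‖folnerVec s y₁ n (Finsupp.single 1 1)‖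
  have t₁ : ‖folnerVec s y₁ n c‖ ≤ 1 / 8 * N + 1 / 8 * N := by
    have : folnerVec s y₁ n c = -(0 - b (folnerVec s y₁ n (Finsupp.single 1 1)))
        - (b (folnerVec s y₁ n (Finsupp.single 1 1)) - folnerVec s y₁ n c) := by abel
    rw [this]
    refine (norm_sub_le _ _).trans ?_
    rw [norm_neg]
    exact add_le_add e₁ hn₁
  have t₂ : N ≤ 1 / 8 * N + 1 / 8 * N + ‖folnerVec s y₂ n c‖ := by
    have : folnerVec s y₂ n (Finsupp.single 1 1) =
        (folnerVec s y₂ n (Finsupp.single 1 1) - b (folnerVec s y₂ n (Finsupp.single 1 1)))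
        + (b (folnerVec s y₂ n (Finsupp.single 1 1)) - folnerVec s y₂ n c)
        + folnerVec s y₂ n c := by abel
    rw [← hN, this]
    refine (norm_add_le _ _).trans ?_
    refine add_le_add ((norm_add_le _ _).trans ?_) le_rfl
    rw [← this, hN]
    exact add_le_add e₂ hn₂
  linarith

end HasCommonAsymptotics

end Asymptotics

/-! ### Invariance of pulled-back subalgebras. -/

section Translation

variable {Γ : Type*} {Y Z : Type*} [Group Γ] [TopologicalSpace Y] [MulAction Γ Y]
  [ContinuousConstSMul Γ Y] [TopologicalSpace Z] [MulAction Γ Z] [ContinuousConstSMul Γ Z]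

/-- The translate `y ↦ f (g y)` of a function vanishing at infinity. -/
def translate (g : Γ) (f : C₀(Y, ℂ)) : C₀(Y, ℂ) :=
  f.comp (Homeomorph.smul g).toCocompactMap

theorem translate_apply (g : Γ) (f : C₀(Y, ℂ)) (y : Y) : translate g f y = f (g • y) := rfl

theorem exists_translate_mem_pullback {p : Y → Z} (hp : ∀ (s : Γ) (y : Y), p (s • y) = s • p y)
    (f : C₀(Y, ℂ)) (hf : f ∈ pullback p) (g : Γ) :
    ∃ f' ∈ pullback p, ∀ y, f' y = f (g • y) := by
  obtain ⟨k, hk⟩ := hf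
  exact ⟨translate g f, ⟨translate g k, fun y => by
    rw [translate_apply, translate_apply, hk, hp]⟩, fun y => rfl⟩

end Translation

theorem pow_smul_eq {G α : Type*} [Monoid G] [MulAction G α] {s : G} {x : α} (hx : s • x = x)
    (k : ℕ) : s ^ k • x = x := by
  induction k with
  | zero => simp
  | succ k ih => rw [pow_succ, mul_smul, hx, ih]

/-! ### The cutoff and the intermediate algebra. -/

section Construction

variable {Γ : Type u} {X : Type v} [Group Γ] [TopologicalSpace X] {ζ : Γ → Circle}

/-- The function `(x, c) ↦ φ x * c 1` on `X × FreeShift ζ`, where `c 1 ∈ {0, 1}` is the second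
component of `c` at the identity. -/
def cutoff (ζ : Γ → Circle) (φ : C₀(X, ℂ)) : C₀(X × FreeShift ζ, ℂ) where
  toFun y := φ y.1 * if (y.2.1 1).2 then 1 else 0
  continuous_toFun := by
    have h : Continuous fun b : Bool => if b then (1 : ℂ) else 0 := continuous_of_discreteTopology
    have h' : Continuous fun y : X × FreeShift ζ => (y.2.1 1).2 :=
      continuous_snd.comp ((continuous_apply 1).comp (FreeShift.continuous_val.comp continuous_snd))
    exact (φ.continuous.comp continuous_fst).mul (h.comp h')
  zero_at_infty' := by
    have h : Filter.Tendsto (fun y : X × FreeShift ζ => φ y.1) (Filter.cocompact _) (nhds 0) := by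
      refine (zero_at_infty φ).comp ?_
      refine Filter.hasBasis_cocompact.tendsto_right_iff.2 fun K hK => ?_
      refine Filter.mem_of_superset (hK.prod isCompact_univ).compl_mem_cocompact ?_
      rintro ⟨x, c⟩ hx
      simpa using hx
    refine squeeze_zero_norm (fun y => ?_) (tendsto_zero_iff_norm_tendsto_zero.1 h)
    rw [norm_mul]
    refine mul_le_of_le_one_right (norm_nonneg _) ?_
    split_ifs <;> simp

theorem cutoff_apply (φ : C₀(X, ℂ)) (y : X × FreeShift ζ) :
    cutoff ζ φ y = φ y.1 * if (y.2.1 1).2 then 1 else 0 := rfl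

variable [MulAction Γ X]

theorem cutoff_smul_apply (φ : C₀(X, ℂ)) (t : Γ) (x : X) (c : FreeShift ζ) :
    cutoff ζ φ (t • (x, c)) = φ (t • x) * if (c.1 t).2 then 1 else 0 := by
  rw [cutoff_apply]
  change φ (t • x) * (if ((t • c).1 1).2 then 1 else 0) = _
  rw [FreeShift.smul_val, one_mul]

variable (ζ) in
/-- The generators `f u_g`, `f ∈ C₀(X)`, together with the element `p - p u_s`, where `p` is the
cutoff function. -/
def intermediateGenerators (s : Γ) (φ : C₀(X, ℂ)) :
    Set (L2 Γ (X × FreeShift ζ) →L[ℂ] L2 Γ (X × FreeShift ζ)) :=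
  insert (mulOp Γ (cutoff ζ φ) - mulOp Γ (cutoff ζ φ) * transOp (X × FreeShift ζ) s)
    {T | ∃ f ∈ pullback (Prod.fst : X × FreeShift ζ → X), ∃ g : Γ,
      T = mulOp Γ f * transOp (X × FreeShift ζ) g}

variable {s : Γ} {x : X} {c₁ c₂ : FreeShift ζ}

-- At `(h * s ^ k) • (x, c)` the cutoff reads the label of `c` at `h * s ^ k`, and this element lies
-- in `⟨s⟩` exactly when `h` does, in which case it fixes `x`. As `φ` need not be real, `f` covers
-- both the cutoff and its adjoint.
open Classical in
theorem mulOp_folnerVec_of_cutoff (hx : s • x = x)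
    (hc₁ : ∀ t, (c₁.1 t).2 = false) (hc₂ : ∀ t, (c₂.1 t).2 = true ↔ t ∈ Subgroup.zpowers s)
    {φ : C₀(X, ℂ)} (hφ : φ x = 1) {f : C₀(X × FreeShift ζ, ℂ)}
    (hf : ∀ y, f y = cutoff ζ φ y ∨ f y = star (cutoff ζ φ y)) (n : ℕ) (h : Γ) (r : ℂ) :
    mulOp Γ f (folnerVec s (x, c₁) n (Finsupp.single h r)) = 0 ∧
    mulOp Γ f (folnerVec s (x, c₂) n (Finsupp.single h r)) =
      if h ∈ Subgroup.zpowers s then folnerVec s (x, c₂) n (Finsupp.single h r) else 0 := by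
  have hst : ∀ {y w}, cutoff ζ φ y = w → star w = w → f y = w := by
    intro y w hw hw'
    rcases hf y with hy | hy
    · rw [hy, hw]
    · rw [hy, hw, hw']
  have hs : ∀ k : ℕ, s ^ k ∈ Subgroup.zpowers s := fun k => Subgroup.npow_mem_zpowers s k
  constructor
  · rw [mulOp_folnerVec_single s (x, c₁) n f h r 0 fun k => hst ?_ (star_zero _)]
    · simp
    · rw [cutoff_smul_apply, hc₁]; simp
  · split_ifs with hh
    · have hhx : h • x = x := by
        obtain ⟨m, rfl⟩ := Subgroup.mem_zpowers_iff.1 hh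
        exact (MulAction.stabilizer Γ x).zpow_mem hx m
      rw [mulOp_folnerVec_single s (x, c₂) n f h r 1 fun k => hst ?_ (star_one _), one_mul]
      rw [cutoff_smul_apply, if_pos ((hc₂ _).2 (mul_mem hh (hs k))), mul_smul,
        pow_smul_eq hx, hhx, hφ, mul_one]
    · rw [mulOp_folnerVec_single s (x, c₂) n f h r 0 fun k => hst ?_ (star_zero _)]
      · simp
      · rw [cutoff_smul_apply, if_neg fun h' => hh ?_, mul_zero]
        simpa using mul_mem ((hc₂ _).1 h') (inv_mem (hs k))

open Asymptotics Filter

/-- Here equality is exact: `f` sees only the `X`-coordinate, which is constant along `g * h * s ^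
j` because `s` fixes `x`. -/
theorem hasCommonAsymptotics_mulOp_mul_transOp (hx : s • x = x)
    {f : C₀(X × FreeShift ζ, ℂ)} (hf : f ∈ pullback (Prod.fst : X × FreeShift ζ → X)) (g : Γ) :
    HasCommonAsymptotics s (x, c₁) (x, c₂) (mulOp Γ f * transOp (X × FreeShift ζ) g) := by
  obtain ⟨k, hk⟩ := hf
  refine .of_single fun h => ⟨Finsupp.single (g * h) (k ((g * h) • x) * 1), fun y hy => ?_⟩
  have hy' : y.1 = x := by rcases hy with rfl | rfl <;> rfl
  refine (isLittleO_zero _ _).congr_left fun n => ?_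
  rw [mul_apply_eq_comp, transOp_folnerVec_single, mulOp_folnerVec_single _ _ _ _ _ _
    (k ((g * h) • x)), sub_self]
  intro j
  rw [hk]
  change k ((g * h * s ^ j) • y.1) = _
  rw [hy', mul_smul _ (s ^ j), pow_smul_eq hx]

/-- If the reduced crossed product of an invariant subalgebra contains `p - p u_s`, where `p` is the
cutoff function and `s ≠ 1`, then it contains the diagonal part `p`. -/
theorem mulOp_cutoff_mem_reducedCrossedProduct (hs : s ≠ 1) {φ : C₀(X, ℂ)}
    {D : NonUnitalStarSubalgebra ℂ C₀(X × FreeShift ζ, ℂ)}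
    (hD : ∀ f ∈ D, ∀ g : Γ, ∃ f' ∈ D, ∀ y, f' y = f (g • y))
    (h : mulOp Γ (cutoff ζ φ) - mulOp Γ (cutoff ζ φ) * transOp (X × FreeShift ζ) s ∈
      reducedCrossedProduct Γ D) :
    mulOp Γ (cutoff ζ φ) ∈ reducedCrossedProduct Γ D := by
  have hclosed : IsClosed (reducedCrossedProduct Γ D :
      Set (L2 Γ (X × FreeShift ζ) →L[ℂ] L2 Γ (X × FreeShift ζ))) :=
    NonUnitalStarSubalgebra.isClosed_topologicalClosure _
  refine hclosed.closure_subset (Metric.mem_closure_iff.2 fun ε hε => ?_)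
  obtain ⟨f, hf, hfy⟩ := exists_mem_norm_sub_diagonal_le hD h (half_pos hε)
  refine ⟨mulOp Γ f, NonUnitalStarSubalgebra.le_topologicalClosure _
    (NonUnitalStarAlgebra.subset_adjoin ℂ _ ⟨f, hf, 1, by rw [transOp_one, mul_one]⟩), ?_⟩
  rw [dist_comm, dist_eq_norm, ← mulOp_sub]
  refine (norm_mulOp_le _).trans_lt (lt_of_le_of_lt ?_ (half_lt_self hε))
  refine (BoundedContinuousFunction.norm_le (half_pos hε).le).2 fun y => ?_
  have hy := hfy y
  rw [sub_apply, mul_apply_eq_comp, transOp_basisVec, mulOp_basisVec, mulOp_basisVec] at hy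
  change ‖f y - (cutoff ζ φ ((1 : Γ) • y) * basisVec (1 : Γ) y (1, y)
    - cutoff ζ φ ((s * 1) • y) * basisVec (s * 1) y (1, y))‖ ≤ ε / 2 at hy
  change ‖f y - cutoff ζ φ y‖ ≤ ε / 2
  simpa [basisVec_apply, Ne.symm hs] using hy

variable [ContinuousConstSMul Γ X]

theorem hasCommonAsymptotics_of_mem_intermediateGenerators (hx : s • x = x)
    (hc₁ : ∀ t, (c₁.1 t).2 = false) (hc₂ : ∀ t, (c₂.1 t).2 = true ↔ t ∈ Subgroup.zpowers s)
    {φ : C₀(X, ℂ)} (hφ : φ x = 1)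
    {T : L2 Γ (X × FreeShift ζ) →L[ℂ] L2 Γ (X × FreeShift ζ)}
    (hT : T ∈ intermediateGenerators ζ s φ) :
    HasCommonAsymptotics s (x, c₁) (x, c₂) T ∧
      HasCommonAsymptotics s (x, c₁) (x, c₂) (star T) := by
  rcases hT with rfl | ⟨f, hf, g, rfl⟩
  · have hcut := fun n h => mulOp_folnerVec_of_cutoff (f := cutoff ζ φ) hx hc₁ hc₂ hφ
      (fun y => .inl rfl) n h 1
    have hcut' := fun n h => mulOp_folnerVec_of_cutoff (f := star (cutoff ζ φ)) hx hc₁ hc₂ hφ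
      (fun y => .inr rfl) n h 1
    constructor
    · refine .of_single fun h => ⟨0, fun y hy => ?_⟩
      simp only [map_zero, sub_zero, sub_apply, mul_apply_eq_comp, transOp_folnerVec_single]
      rcases hy with rfl | rfl
      · simp only [(hcut _ _).1, sub_self]
        exact isLittleO_zero _ _
      · by_cases hh : h ∈ Subgroup.zpowers s
        -- Inside `⟨s⟩`, left translation by `s` is the right shift under which the sums are almost
        -- invariant.
        · have hcomm : s * h = h * s := by
            obtain ⟨m, rfl⟩ := Subgroup.mem_zpowers_iff.1 hh
            exact (Commute.refl s).zpow_right m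
          have hsh : s * h ∈ Subgroup.zpowers s := mul_mem (Subgroup.mem_zpowers s) hh
          simp only [(hcut _ _).2, if_pos hh, if_pos hsh]
          exact isLittleO_folnerVec_sub s _ (.inl hcomm)
        · have hsh : s * h ∉ Subgroup.zpowers s := fun h' => hh <| by
            simpa using mul_mem (inv_mem (Subgroup.mem_zpowers s)) h'
          simp only [(hcut _ _).2, if_neg hh, if_neg hsh, sub_self]
          exact isLittleO_zero _ _
    · rw [star_sub, star_mul, star_mulOp, star_transOp]
      refine .of_single fun h => ⟨0, fun y hy => ?_⟩
      simp only [map_zero, sub_zero, sub_apply, mul_apply_eq_comp]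
      rcases hy with rfl | rfl
      · simp only [(hcut' _ _).1, map_zero, sub_self]
        exact isLittleO_zero _ _
      · by_cases hh : h ∈ Subgroup.zpowers s
        · have hcomm : h = s⁻¹ * h * s := by
            obtain ⟨m, rfl⟩ := Subgroup.mem_zpowers_iff.1 hh
            group
          simp only [(hcut' _ _).2, if_pos hh, transOp_folnerVec_single]
          exact isLittleO_folnerVec_sub s _ (.inr hcomm)
        · simp only [(hcut' _ _).2, if_neg hh, map_zero, sub_self]
          exact isLittleO_zero _ _
  · refine ⟨hasCommonAsymptotics_mulOp_mul_transOp hx hf g, ?_⟩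
    obtain ⟨f', hf', h⟩ := exists_translate_mem_pullback (Γ := Γ) (fun _ _ => rfl)
      (star f) (star_mem hf) g
    rw [star_mul, star_mulOp, star_transOp, transOp_mul_mulOp g⁻¹ (by simpa using h)]
    exact hasCommonAsymptotics_mulOp_mul_transOp hx hf' g⁻¹

end Construction

end CrossedProduct

end

/-! ### Assembly of the counterexample. -/

open CrossedProduct in
theorem proposition2p6 {Γ : Type u} [Group Γ] {X : Type v} [TopologicalSpace X]
    [T2Space X] [LocallyCompactSpace X] [MulAction Γ X] [ContinuousConstSMul Γ X]
    (hX : ¬ CrossedProduct.IsFreeAction Γ X) :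
    ∃ (Y : Type (max u v)) (_ : TopologicalSpace Y) (_ : T2Space Y) (_ : LocallyCompactSpace Y)
      (_ : MulAction Γ Y) (_ : ContinuousConstSMul Γ Y) (π : Y → X),
      CrossedProduct.IsFreeAction Γ Y ∧
      CrossedProduct.IsProperFactorMap Γ π ∧
      ∃ A : NonUnitalStarSubalgebra ℂ (CrossedProduct.L2 Γ Y →L[ℂ] CrossedProduct.L2 Γ Y),
        IsClosed (A : Set (CrossedProduct.L2 Γ Y →L[ℂ] CrossedProduct.L2 Γ Y)) ∧
        CrossedProduct.reducedCrossedProduct Γ (CrossedProduct.pullback π) ≤ A ∧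
        A ≤ CrossedProduct.reducedCrossedProduct Γ
          (⊤ : NonUnitalStarSubalgebra ℂ (ZeroAtInftyContinuousMap Y ℂ)) ∧
        ∀ (Z : Type (max u v)) [TopologicalSpace Z] [T2Space Z] [LocallyCompactSpace Z]
          [MulAction Γ Z] [ContinuousConstSMul Γ Z] (p : Y → Z) (q : Z → X),
          CrossedProduct.IsFactorMap Γ p → CrossedProduct.IsFactorMap Γ q → q ∘ p = π →
          A ≠ CrossedProduct.reducedCrossedProduct Γ (CrossedProduct.pullback p) := by
  classical
  obtain ⟨s, x, hx, hs⟩ : ∃ (s : Γ) (x : X), s • x = x ∧ s ≠ 1 := by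
    simpa [IsFreeAction] using hX
  obtain ⟨ζ, hζ, hrot⟩ := exists_rotation_factor Γ
  obtain ⟨c₁, hc₁⟩ := FreeShift.exists_snd_eq hrot fun _ => false
  obtain ⟨c₂, hc₂⟩ := FreeShift.exists_snd_eq hrot fun t => decide (t ∈ Subgroup.zpowers s)
  have hc₂' : ∀ t, (c₂.1 t).2 = true ↔ t ∈ Subgroup.zpowers s := fun t => by simp [hc₂ t]
  have : Nonempty (FreeShift ζ) := ⟨c₁⟩
  obtain ⟨φ, hφ⟩ : ∃ φ : C₀(X, ℂ), φ x = 1 := by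
    obtain ⟨f, hf, -, hfc, -⟩ := exists_continuous_one_zero_of_isCompact
      (isCompact_singleton (x := x)) isClosed_empty (Set.disjoint_empty _)
    refine ⟨⟨⟨fun y => (f y : ℂ), by fun_prop⟩, ?_⟩, ?_⟩
    · exact (hfc.comp_left (g := fun r : ℝ => (r : ℂ)) (by simp)).is_zero_at_infty
    · change ((f x : ℝ) : ℂ) = 1
      simp [hf rfl]
  refine ⟨X × FreeShift ζ, inferInstance, inferInstance, inferInstance, inferInstance,
    inferInstance, Prod.fst, fun g y hy => FreeShift.isFreeAction hζ g y.2 (congrArg Prod.snd hy),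
    ⟨⟨isQuotientMap_fst, fun _ _ => rfl⟩, fun K hK => ?_⟩,
    (NonUnitalStarAlgebra.adjoin ℂ (intermediateGenerators ζ s φ)).topologicalClosure,
    NonUnitalStarSubalgebra.isClosed_topologicalClosure _, ?_, ?_, ?_⟩
  · have := hK.prod (isCompact_univ (X := FreeShift ζ))
    rwa [Set.prod_univ] at this
  · exact NonUnitalStarSubalgebra.topologicalClosure_mono
      (NonUnitalStarAlgebra.adjoin_mono (Set.subset_insert _ _))
  · refine NonUnitalStarSubalgebra.topologicalClosure_minimal _
      (NonUnitalStarAlgebra.adjoin_le ?_) (NonUnitalStarSubalgebra.isClosed_topologicalClosure _)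
    have hgen : ∀ (f : C₀(X × FreeShift ζ, ℂ)) (g : Γ), mulOp Γ f * transOp _ g ∈
        reducedCrossedProduct Γ (⊤ : NonUnitalStarSubalgebra ℂ C₀(X × FreeShift ζ, ℂ)) :=
      fun f g => NonUnitalStarSubalgebra.le_topologicalClosure _
        (NonUnitalStarAlgebra.subset_adjoin ℂ _ ⟨f, NonUnitalStarAlgebra.mem_top, g, rfl⟩)
    rintro T (rfl | ⟨f, -, g, rfl⟩)
    · have h1 := hgen (cutoff ζ φ) 1
      rw [transOp_one, mul_one] at h1
      exact sub_mem h1 (hgen _ s)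
    · exact hgen f g
  · intro Z _ _ _ _ _ p q hp _ _ hA
    have hmem : mulOp Γ (cutoff ζ φ) - mulOp Γ (cutoff ζ φ) * transOp (X × FreeShift ζ) s ∈
        (NonUnitalStarAlgebra.adjoin ℂ (intermediateGenerators ζ s φ)).topologicalClosure :=
      NonUnitalStarSubalgebra.le_topologicalClosure _
        (NonUnitalStarAlgebra.subset_adjoin ℂ _ (Set.mem_insert _ _))
    rw [hA] at hmem
    -- The expectation forces the cutoff itself into `A`, which the two test points rule out.
    have hcut := mulOp_cutoff_mem_reducedCrossedProduct hs
      (exists_translate_mem_pullback hp.equivariant) hmem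
    rw [← hA] at hcut
    have hvec := fun n => mulOp_folnerVec_of_cutoff (f := cutoff ζ φ) hx hc₁ hc₂' hφ
      (fun y => .inl rfl) n 1 1
    refine HasCommonAsymptotics.notMem_closure (s := s) (y₁ := (x, c₁)) (y₂ := (x, c₂))
      (fun b hb => HasCommonAsymptotics.of_mem_adjoin
        (fun T hT => hasCommonAsymptotics_of_mem_intermediateGenerators hx hc₁ hc₂' hφ hT) hb)
      (fun n => (hvec n).1) (fun n => ?_) hcut
    rw [(hvec n).2, if_pos (one_mem _)]
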